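/- Let $k\ge 1$ be an integer and let $M$ be a real number. For a complex $k\times k$ matrix $A$ write $\|A\|=\max_{1\le j\le k}\sum_{i=1}^k|A_{ij}|$ for the operator $1$-norm, and for invertible $A$ let $\operatorname{cond}(A)=\|A\|\,\|A^{-1}\|$ be its condition number. Then there is a constant $c=c(k,M)>0$, depending only on $k$ and $M$, with the following property. Let $\mathcal A$ be a finite set of invertible $k\times k$ complex matrices with $|\mathcal A|\ge 2$ and $\operatorname{cond}(A)\le M$ for every $A\in\mathcal A$ (for instance, $M=\max_{A\in\mathcal A}\operatorname{cond}(A)$). Suppose that for all $A,B,C,D\in\mathcal A$ (not necessarily distinct), either $AB^{-1}=CD^{-1}$ or the $2k\times 2k$ block matrix $\begin{pmatrix}A&C\\ B&D\end{pmatrix}$ is invertible. Then $$\max\bigl(|\mathcal A+\mathcal A|,\,|\mathcal A\mathcal A|\bigr)\ \ge\ c\,\frac{|\mathcal A|^{4/3}}{\lceil\log|\mathcal A|\rceil^{1/3}},$$ where $\mathcal A+\mathcal A=\{A+B:A,B\in\mathcal A\}$, $\mathcal A\mathcal A=\{AB:A,B\in\mathcal A\}$ and $\log$ is the natural logarithm.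 -/

import Mathlib

open scoped Pointwise

noncomputable section

/-- The operator `1`-norm of a complex `k × k` matrix: the maximum absolute column sum
`max_j ∑_i |A i j|` (with value `0` for `k = 0`). -/
def opOneNorm {k : ℕ} (A : Matrix (Fin k) (Fin k) ℂ) : ℝ :=
  ⨆ j : Fin k, ∑ i : Fin k, ‖A i j‖

/-- The condition number `‖A‖ ‖A⁻¹‖` of a matrix (meaningful for invertible `A`),
in the operator `1`-norm. -/
def condNumber {k : ℕ} (A : Matrix (Fin k) (Fin k) ℂ) : ℝ :=
  opOneNorm A * opOneNorm A⁻¹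

end

/-! The argument adapts the sum-product proof in which each slope `g = a * b⁻¹` is paired with a
nearest other slope `g' = c * d⁻¹`, and the representations of both are added to give a pair of sums
`(x, y) = (a + c, b + d)`. Then `x - g * y = (g' - g) * d`. The block condition makes `g' - g`
invertible, so `(x, y)` and `g` determine `a, b, c, d`.

How many `g` can give the same `(x, y)`? After restriction to a narrow cone, at a cost of a bounded
factor in cardinality, `y` is invertible and `‖d * y⁻¹‖ ≤ 1`. So `x * y⁻¹` is no further from `g`
than `g'` is, hence no further than any other slope in the set. A Besicovitch-type argument bounds
the number of such `g` by the dimension (`card_le_of_norm_sub_le_norm_sub`). Thus slopes with at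
least `N` representations number `O(|A + A|² / N²)` (`card_mul_sq_le_of_le_card_quotientRep`).
Dyadic summation bounds the multiplicative energy by `O(|A + A|² log |A|)`, and Cauchy–Schwarz
bounds it below by `|A|⁴ / |AA|`. -/

/-! ### Geometry of normed spaces and normed algebras. -/

/-- A finite set of points, each of which is at least as far from the others as from `p`, has
cardinality bounded in terms of the dimension. -/
theorem card_le_of_norm_sub_le_norm_sub {E : Type*} [NormedAddCommGroup E] [NormedSpace ℝ E]
    [FiniteDimensional ℝ E] (T : Finset E) (p : E)
    (h : ∀ x ∈ T, ∀ y ∈ T, x ≠ y → ‖p - x‖ ≤ ‖x - y‖) :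
    T.card ≤ 5 ^ Module.finrank ℝ E + 1 := by
  classical
  have key : ∀ x ∈ T.erase p, ∀ y ∈ T.erase p, x ≠ y → ‖y - p‖ ≤ ‖x - p‖ →
      1 ≤ ‖‖x - p‖⁻¹ • (x - p) - ‖y - p‖⁻¹ • (y - p)‖ := by
    intro x hx y hy hxy hle
    have hx0 : 0 < ‖x - p‖ := norm_pos_iff.2 (sub_ne_zero.2 (Finset.ne_of_mem_erase hx))
    have hy0 : 0 < ‖y - p‖ := norm_pos_iff.2 (sub_ne_zero.2 (Finset.ne_of_mem_erase hy))
    have h1 := h x (Finset.mem_of_mem_erase hx) y (Finset.mem_of_mem_erase hy) hxy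
    rw [norm_sub_rev] at h1
    set u := ‖x - p‖⁻¹ • (x - p) with hu
    set v := ‖y - p‖⁻¹ • (y - p) with hv
    have hu1 : ‖u‖ = 1 := by
      rw [hu, norm_smul, norm_inv, norm_norm, inv_mul_cancel₀ hx0.ne']
    have hxu : x - p = ‖x - p‖ • u := by rw [hu, smul_inv_smul₀ hx0.ne']
    have hyv : y - p = ‖y - p‖ • v := by rw [hv, smul_inv_smul₀ hy0.ne']
    -- Only the shorter length multiplies `u - v`; the excess length of `x - p` lies along `u`. The
    -- triangle inequality then forces `‖u - v‖ ≥ 1`, so the directions from `p` are separated.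
    have h2 : x - y = ‖y - p‖ • (u - v) + (‖x - p‖ - ‖y - p‖) • u := by
      have : x - y = (x - p) - (y - p) := by abel
      rw [this, sub_smul, smul_sub, ← hxu, ← hyv]; abel
    have h3 : ‖x - y‖ ≤ ‖y - p‖ * ‖u - v‖ + (‖x - p‖ - ‖y - p‖) := by
      rw [h2]
      refine (norm_add_le _ _).trans (le_of_eq ?_)
      rw [norm_smul, norm_smul, hu1, norm_norm, Real.norm_of_nonneg (sub_nonneg.2 hle), mul_one]
    have h4 : ‖y - p‖ * 1 ≤ ‖y - p‖ * ‖u - v‖ := by linarith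
    exact le_of_mul_le_mul_left h4 hy0
  have sep : ∀ x ∈ T.erase p, ∀ y ∈ T.erase p, x ≠ y →
      1 ≤ ‖‖x - p‖⁻¹ • (x - p) - ‖y - p‖⁻¹ • (y - p)‖ := by
    intro x hx y hy hxy
    rcases le_total ‖y - p‖ ‖x - p‖ with hle | hle
    · exact key x hx y hy hxy hle
    · rw [norm_sub_rev]; exact key y hy x hx hxy.symm hle
  have hinj : Set.InjOn (fun x : E => ‖x - p‖⁻¹ • (x - p)) (T.erase p : Finset E) := by
    intro x hx y hy hxy
    by_contra hne
    have := sep x hx y hy hne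
    simp only at hxy
    rw [hxy, sub_self, norm_zero] at this
    linarith
  have hcard : (T.erase p).card ≤ 5 ^ Module.finrank ℝ E := by
    rw [← Finset.card_image_of_injOn hinj]
    refine Besicovitch.card_le_of_separated _ ?_ ?_
    · intro c hc
      obtain ⟨x, -, rfl⟩ := Finset.mem_image.1 hc
      rw [norm_smul, norm_inv, norm_norm]
      exact (inv_mul_le_one).trans one_le_two
    · intro c hc d hd hcd
      obtain ⟨x, hx, rfl⟩ := Finset.mem_image.1 hc
      obtain ⟨y, hy, rfl⟩ := Finset.mem_image.1 hd
      exact sep x hx y hy fun h => hcd (by rw [h])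
  -- The extra `1` allows for `p` itself lying in `T`.
  have := Finset.pred_card_le_card_erase (s := T) (a := p)
  omega

/-- If `b * d⁻¹` is close to a positive scalar, then `b + d` is invertible and dividing `d` by it
does not increase norms. -/
theorem exists_unit_add_norm_mul_inv_le_one {R : Type*} [NormedRing R] [NormedAlgebra ℝ R]
    [CompleteSpace R] [NormOneClass R] (b d : Rˣ) {s : ℝ} (hs : 0 < s)
    (h : ‖((b * d⁻¹ : Rˣ) : R) - algebraMap ℝ R s‖ < s) :
    ∃ y : Rˣ, (y : R) = b + d ∧ ‖(d : R) * (y⁻¹ : Rˣ)‖ ≤ 1 := by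
  set e : R := ((b * d⁻¹ : Rˣ) : R) - algebraMap ℝ R s with he
  have hs1 : (1 + s) ≠ 0 := by positivity
  have hb : (b : R) = (algebraMap ℝ R s + e) * d := by
    rw [he, add_sub_cancel, ← Units.val_mul, inv_mul_cancel_right]
  have hsum : (b : R) + d = (algebraMap ℝ R (1 + s) + e) * d := by
    rw [hb, map_add, map_one]; noncomm_ring
  have hu : IsUnit (algebraMap ℝ R (1 + s) + e) := by
    have hn : ‖-(algebraMap ℝ R (1 + s)⁻¹ * e)‖ < 1 := by
      rw [norm_neg]
      refine (norm_mul_le _ _).trans_lt ?_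
      rw [norm_algebraMap', norm_inv, Real.norm_of_nonneg (by positivity), inv_mul_lt_iff₀
        (by positivity)]
      linarith
    have h1 := isUnit_one_sub_of_norm_lt_one hn
    have h2 : IsUnit (algebraMap ℝ R (1 + s)) := (IsUnit.mk0 _ hs1).map _
    have h3 := h2.mul h1
    rwa [sub_neg_eq_add, mul_add, mul_one, ← mul_assoc, ← map_mul, mul_inv_cancel₀ hs1, map_one,
      one_mul] at h3
  obtain ⟨v, hv⟩ := hu
  refine ⟨v * d, by rw [Units.val_mul, hv, hsum], ?_⟩
  set w : R := (d : R) * ((v * d)⁻¹ : Rˣ) with hw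
  have hw1 : (algebraMap ℝ R (1 + s) + e) * w = 1 := by
    rw [hw, ← hv, ← Units.val_mul, ← Units.val_mul, ← mul_assoc, mul_inv_cancel, Units.val_one]
  -- From `(1 + s) w = 1 - e w` and `‖e‖ < s`, the terms `s * ‖w‖` cancel and exactly `‖w‖ ≤ 1`
  -- remains.
  have h4 : (1 + s) * ‖w‖ ≤ 1 + s * ‖w‖ := by
    have h5 : (1 + s) • w = 1 - e * w := by
      rw [← hw1, add_mul, Algebra.smul_def]; abel
    calc (1 + s) * ‖w‖ = ‖(1 + s) • w‖ := by
          rw [norm_smul, Real.norm_of_nonneg (by positivity)]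
      _ ≤ ‖(1 : R)‖ + ‖e * w‖ := h5 ▸ norm_sub_le _ _
      _ ≤ 1 + s * ‖w‖ := by
          rw [norm_one]
          gcongr
          exact (norm_mul_le _ _).trans (by gcongr)
  linarith

/-! ### Rich quotients and pairs of sums. -/

/-- The number of representations of `g` as a quotient `a / b` with `a, b ∈ S`. -/
def quotientRep {G : Type*} [Group G] [DecidableEq G] (S : Finset G) (g : G) : Finset (G × G) :=
  {p ∈ S ×ˢ S | p.1 * p.2⁻¹ = g}

theorem mem_quotientRep {G : Type*} [Group G] [DecidableEq G] {S : Finset G} {g : G} {p : G × G} :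
    p ∈ quotientRep S g ↔ (p.1 ∈ S ∧ p.2 ∈ S) ∧ p.1 * p.2⁻¹ = g := by
  rw [quotientRep, Finset.mem_filter, Finset.mem_product]

theorem card_quotientRep_le {G : Type*} [Group G] [DecidableEq G] (S : Finset G) (g : G) :
    (quotientRep S g).card ≤ S.card := by
  refine Finset.card_le_card_of_injOn Prod.snd (fun p hp => (mem_quotientRep.1 hp).1.2) ?_
  intro p hp q hq hpq
  have h1 := (mem_quotientRep.1 hp).2
  have h2 := (mem_quotientRep.1 hq).2
  rw [← h2, hpq] at h1
  exact Prod.ext (mul_right_cancel h1) hpq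

/-- If every element of `L` has at least `N` representations as a quotient of elements of `S`,
then there are many distinct pairs of sums. -/
theorem card_mul_sq_le_of_le_card_quotientRep {R : Type*} [NormedRing R] [NormedAlgebra ℝ R]
    [FiniteDimensional ℝ R] [NormOneClass R] [DecidableEq Rˣ] (S : Finset Rˣ)
    (hcone : ∀ b ∈ S, ∀ d ∈ S, ∃ s : ℝ, 0 < s ∧ ‖((b * d⁻¹ : Rˣ) : R) - algebraMap ℝ R s‖ < s)
    (hdiff : ∀ a ∈ S, ∀ b ∈ S, ∀ c ∈ S, ∀ d ∈ S, a * b⁻¹ ≠ c * d⁻¹ →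
      IsUnit (((a * b⁻¹ : Rˣ) : R) - ((c * d⁻¹ : Rˣ) : R)))
    (T : Finset R) (hT : ∀ a ∈ S, ∀ b ∈ S, (a + b : R) ∈ T)
    (L : Finset Rˣ) (N : ℕ) (hL : ∀ g ∈ L, N ≤ (quotientRep S g).card) :
    L.card * N ^ 2 ≤ (5 ^ Module.finrank ℝ R + 1) * T.card ^ 2 := by
  classical
  have : CompleteSpace R := FiniteDimensional.complete ℝ R
  -- A single quotient has no neighbour; here `N ≤ |S| ≤ |T|` suffices.
  rcases le_or_gt L.card 1 with hL1 | hL1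
  · rcases L.eq_empty_or_nonempty with rfl | ⟨g, hg⟩
    · simp
    have hST : S.card ≤ T.card := by
      rcases S.eq_empty_or_nonempty with rfl | ⟨a, ha⟩
      · simp
      refine Finset.card_le_card_of_injOn (fun b => (a + b : R)) (fun b hb => hT a ha b hb) ?_
      intro b _ c _ hbc
      exact Units.ext (add_left_cancel hbc)
    calc L.card * N ^ 2 ≤ 1 * T.card ^ 2 := by
          gcongr
          exact (hL g hg).trans ((card_quotientRep_le S g).trans hST)
      _ ≤ _ := Nat.mul_le_mul_right _ (Nat.le_add_left _ _)
  have hnear : ∀ g ∈ L, ∃ g' ∈ L, g' ≠ g ∧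
      ∀ x ∈ L, x ≠ g → ‖(g' : R) - g‖ ≤ ‖(x : R) - g‖ := by
    intro g hg
    have hne : (L.erase g).Nonempty := by
      rw [← Finset.card_pos, Finset.card_erase_of_mem hg]; omega
    obtain ⟨g', hg', hmin⟩ := (L.erase g).exists_min_image (fun x => ‖(x : R) - g‖) hne
    exact ⟨g', Finset.mem_of_mem_erase hg', Finset.ne_of_mem_erase hg',
      fun x hx hxg => hmin x (Finset.mem_erase.2 ⟨hxg, hx⟩)⟩
  choose! near hnL hne hmin using hnear
  let U : Finset (Σ _ : Rˣ, (Rˣ × Rˣ) × (Rˣ × Rˣ)) :=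
    L.sigma fun g => quotientRep S g ×ˢ quotientRep S (near g)
  have hU : L.card * N ^ 2 ≤ U.card := by
    rw [Finset.card_sigma, ← smul_eq_mul]
    refine Finset.card_nsmul_le_sum _ _ _ fun g hg => ?_
    rw [Finset.card_product, sq]
    exact Nat.mul_le_mul (hL g hg) (hL _ (hnL g hg))
  let F : (Σ _ : Rˣ, (Rˣ × Rˣ) × (Rˣ × Rˣ)) → R × R :=
    fun u => ((u.2.1.1 : R) + u.2.2.1, (u.2.1.2 : R) + u.2.2.2)
  have memU : ∀ u ∈ U, u.1 ∈ L ∧ u.2.1 ∈ quotientRep S u.1 ∧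
      u.2.2 ∈ quotientRep S (near u.1) := by
    intro u hu
    obtain ⟨h1, h2⟩ := Finset.mem_sigma.1 hu
    exact ⟨h1, Finset.mem_product.1 h2⟩
  have hval : ∀ u ∈ U, (u.2.1.1 : R) = u.1 * u.2.1.2 ∧ (u.2.2.1 : R) = near u.1 * u.2.2.2 := by
    intro u hu
    obtain ⟨-, h2, h3⟩ := memU u hu
    have h4 := (mem_quotientRep.1 h2).2
    have h5 := (mem_quotientRep.1 h3).2
    rw [mul_inv_eq_iff_eq_mul] at h4 h5
    rw [← Units.val_mul, ← Units.val_mul, ← h4, ← h5]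
    exact ⟨rfl, rfl⟩
  -- This identity serves twice: it recovers `d` from the sums and `g`, and it measures how far `g`
  -- is from the quotient of the two sums.
  have hsub : ∀ u ∈ U, (F u).1 - u.1 * (F u).2 = ((near u.1 : R) - u.1) * u.2.2.2 := by
    intro u hu
    obtain ⟨h1, h2⟩ := hval u hu
    simp only [F]
    rw [h1, h2]; noncomm_ring
  have hunit : ∀ u ∈ U, IsUnit ((near u.1 : R) - u.1) := by
    intro u hu
    obtain ⟨h1, h2, h3⟩ := memU u hu
    obtain ⟨⟨ha, hb⟩, hab⟩ := mem_quotientRep.1 h2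
    obtain ⟨⟨hc, hd⟩, hcd⟩ := mem_quotientRep.1 h3
    have := hdiff _ hc _ hd _ ha _ hb (by rw [hab, hcd]; exact hne _ h1)
    rwa [hab, hcd] at this
  have hmaps : ∀ u ∈ U, F u ∈ T ×ˢ T := by
    intro u hu
    obtain ⟨-, h2, h3⟩ := memU u hu
    obtain ⟨⟨ha, hb⟩, -⟩ := mem_quotientRep.1 h2
    obtain ⟨⟨hc, hd⟩, -⟩ := mem_quotientRep.1 h3
    exact Finset.mem_product.2 ⟨hT _ ha _ hc, hT _ hb _ hd⟩
  have hfib : ∀ z ∈ T ×ˢ T, {u ∈ U | F u = z}.card ≤ 5 ^ Module.finrank ℝ R + 1 := by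
    intro z _
    have hinj : Set.InjOn (fun u : (Σ _ : Rˣ, (Rˣ × Rˣ) × (Rˣ × Rˣ)) => (u.1 : R))
        ({u ∈ U | F u = z} : Finset _) := by
      rintro ⟨g, ⟨a, b⟩, c, d⟩ hu ⟨g', ⟨a', b'⟩, c', d'⟩ hu' hgg
      obtain ⟨hu, hz⟩ := Finset.mem_filter.1 hu
      obtain ⟨hu', hz'⟩ := Finset.mem_filter.1 hu'
      obtain rfl : g = g' := Units.ext hgg
      have e1 := hsub _ hu
      have e2 := hsub _ hu'
      rw [hz] at e1
      rw [hz', e1] at e2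
      have hd : (d : R) = d' := (hunit _ hu).mul_left_cancel e2
      have hz2 := hz.trans hz'.symm
      obtain ⟨hz3, hz4⟩ := Prod.mk.inj hz2
      simp only at hz3 hz4
      have hb : (b : R) = b' := by rw [hd] at hz4; exact add_right_cancel hz4
      have v1 := hval _ hu
      have v2 := hval _ hu'
      simp only at v1 v2
      have ha : (a : R) = a' := by rw [v1.1, v2.1, hb]
      have hc : (c : R) = c' := by rw [v1.2, v2.2, hd]
      rw [Units.ext ha, Units.ext hb, Units.ext hc, Units.ext hd]
    rw [← Finset.card_image_of_injOn hinj]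
    rcases Finset.eq_empty_or_nonempty {u ∈ U | F u = z} with h0 | ⟨u₀, hu₀⟩
    · rw [h0]; simp
    obtain ⟨hu₀, hz₀⟩ := Finset.mem_filter.1 hu₀
    have hy : ∀ u ∈ U, ∃ y : Rˣ, (y : R) = (F u).2 ∧ ‖(u.2.2.2 : R) * (y⁻¹ : Rˣ)‖ ≤ 1 := by
      intro u hu
      obtain ⟨-, h2, h3⟩ := memU u hu
      obtain ⟨⟨-, hb⟩, -⟩ := mem_quotientRep.1 h2
      obtain ⟨⟨-, hd⟩, -⟩ := mem_quotientRep.1 h3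
      obtain ⟨s, hs, hbd⟩ := hcone _ hb _ hd
      exact exists_unit_add_norm_mul_inv_le_one _ _ hs hbd
    obtain ⟨y, hyz, -⟩ := hy u₀ hu₀
    rw [hz₀] at hyz
    -- The centre is the quotient of the two sums, which is the same for the whole fibre.
    refine card_le_of_norm_sub_le_norm_sub _ (z.1 * (y⁻¹ : Rˣ)) ?_
    intro x hx x' hx' hxx
    obtain ⟨u, hu, rfl⟩ := Finset.mem_image.1 hx
    obtain ⟨u', hu', rfl⟩ := Finset.mem_image.1 hx'
    obtain ⟨hu, hz⟩ := Finset.mem_filter.1 hu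
    obtain ⟨hu', -⟩ := Finset.mem_filter.1 hu'
    obtain ⟨y', hy', hle⟩ := hy u hu
    obtain rfl : y' = y := Units.ext (by rw [hy', hz, hyz])
    have e1 := hsub u hu
    rw [hz, ← hyz] at e1
    have e2 : z.1 * (y'⁻¹ : Rˣ) - u.1 = ((near u.1 : R) - u.1) * (u.2.2.2 * (y'⁻¹ : Rˣ)) := by
      rw [← mul_assoc, ← e1, sub_mul, mul_assoc (u.1 : R), Units.mul_inv, mul_one]
    rw [e2]
    calc _ ≤ ‖(near u.1 : R) - u.1‖ * ‖(u.2.2.2 : R) * (y'⁻¹ : Rˣ)‖ := norm_mul_le _ _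
      _ ≤ ‖(near u.1 : R) - u.1‖ := mul_le_of_le_one_right (norm_nonneg _) hle
      _ ≤ ‖(u'.1 : R) - u.1‖ :=
          hmin _ (memU u hu).1 _ (memU u' hu').1 fun h => hxx (by rw [h])
      _ = _ := norm_sub_rev _ _
  calc L.card * N ^ 2 ≤ U.card := hU
    _ ≤ (5 ^ Module.finrank ℝ R + 1) * (T ×ˢ T).card :=
        Finset.card_le_mul_card_image_of_maps_to hmaps _ hfib
    _ = _ := by rw [Finset.card_product, sq]

/-! ### Multiplicative energy and dyadic levels. -/

theorem card_filter_product_eq_sum {α β G : Type*} [DecidableEq G] (X : Finset α) (Y : Finset β)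
    (f : α → G) (h : β → G) (V : Finset G) (hf : ∀ x ∈ X, f x ∈ V) :
    {z ∈ X ×ˢ Y | f z.1 = h z.2}.card =
      ∑ g ∈ V, {x ∈ X | f x = g}.card * {y ∈ Y | h y = g}.card := by
  rw [Finset.card_eq_sum_card_fiberwise (f := fun z => f z.1) (t := V)
    fun z hz => hf _ (Finset.mem_product.1 (Finset.mem_filter.1 hz).1).1]
  refine Finset.sum_congr rfl fun g _ => ?_
  rw [← Finset.card_product]
  congr 1
  ext z
  simp only [Finset.mem_filter, Finset.mem_product]
  constructor
  · rintro ⟨⟨⟨h1, h2⟩, h3⟩, h4⟩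
    exact ⟨⟨h1, h4⟩, h2, h3 ▸ h4⟩
  · rintro ⟨⟨h1, h4⟩, h2, h5⟩
    exact ⟨⟨⟨h1, h2⟩, h4.trans h5.symm⟩, h4⟩

/-- The number of coincidences of two functions is at most the average of the numbers of
coincidences of each of them with itself. -/
theorem two_mul_card_filter_product_le {α G : Type*} [DecidableEq G] (X : Finset α)
    (f h : α → G) :
    2 * {z ∈ X ×ˢ X | f z.1 = h z.2}.card ≤
      {z ∈ X ×ˢ X | f z.1 = f z.2}.card + {z ∈ X ×ˢ X | h z.1 = h z.2}.card := by
  have hf : ∀ x ∈ X, f x ∈ X.image f ∪ X.image h := fun x hx =>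
    Finset.mem_union_left _ (Finset.mem_image_of_mem f hx)
  have hh : ∀ x ∈ X, h x ∈ X.image f ∪ X.image h := fun x hx =>
    Finset.mem_union_right _ (Finset.mem_image_of_mem h hx)
  rw [card_filter_product_eq_sum X X f h _ hf, card_filter_product_eq_sum X X f f _ hf,
    card_filter_product_eq_sum X X h h _ hh, Finset.mul_sum, ← Finset.sum_add_distrib]
  refine Finset.sum_le_sum fun g _ => ?_
  nlinarith [two_mul_le_add_sq {x ∈ X | f x = g}.card {x ∈ X | h x = g}.card]

/-- The multiplicative energy is bounded by the second moment of the number of representations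
as a quotient. -/
theorem mulEnergy_le_sum_card_quotientRep_sq {G : Type*} [Group G] [DecidableEq G]
    (S : Finset G) :
    Finset.mulEnergy S S ≤
      ∑ g ∈ (S ×ˢ S).image (fun p => p.1 * p.2⁻¹), (quotientRep S g).card ^ 2 := by
  set X := S ×ˢ S with hX
  set E := {z ∈ X ×ˢ X | z.1.1 * z.1.2⁻¹ = z.2.1 * z.2.2⁻¹}.card with hE
  have h0 : ∑ g ∈ X.image (fun p => p.1 * p.2⁻¹), (quotientRep S g).card ^ 2 = E := by
    rw [hE, card_filter_product_eq_sum X X (fun p : G × G => p.1 * p.2⁻¹)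
      (fun p : G × G => p.1 * p.2⁻¹) _ fun x hx => Finset.mem_image_of_mem _ hx]
    exact Finset.sum_congr rfl fun g _ => sq _
  -- Without commutativity, the energy compares a left quotient with a right quotient. Averaging
  -- replaces it by left-left and right-right coincidences, and both kinds rearrange into
  -- coincidences of right quotients.
  have h1 : Finset.mulEnergy S S =
      {z ∈ X ×ˢ X | z.1.2⁻¹ * z.1.1 = z.2.2 * z.2.1⁻¹}.card := by
    rw [Finset.mulEnergy]
    congr 1
    refine Finset.filter_congr fun z _ => ?_
    rw [inv_mul_eq_iff_eq_mul, ← mul_assoc, eq_mul_inv_iff_mul_eq]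
  have h2 := two_mul_card_filter_product_le X (fun x : G × G => x.2⁻¹ * x.1)
    (fun x : G × G => x.2 * x.1⁻¹)
  have h3 : {z ∈ X ×ˢ X | z.1.2⁻¹ * z.1.1 = z.2.2⁻¹ * z.2.1}.card ≤ E := by
    refine Finset.card_le_card_of_injOn (fun z => ((z.2.2, z.1.2), (z.2.1, z.1.1))) ?_ ?_
    · rintro ⟨⟨a, b⟩, c, d⟩ hz
      simp only [hX, Finset.coe_filter, Finset.mem_product, Set.mem_ofPred_eq] at hz ⊢
      refine ⟨by tauto, ?_⟩
      rw [eq_mul_inv_iff_mul_eq, mul_assoc, hz.2, mul_inv_cancel_left]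
    · rintro ⟨⟨a, b⟩, c, d⟩ _ ⟨⟨a', b'⟩, c', d'⟩ _ h
      simp only [Prod.mk.injEq] at h ⊢
      tauto
  have h4 : {z ∈ X ×ˢ X | z.1.2 * z.1.1⁻¹ = z.2.2 * z.2.1⁻¹}.card ≤ E := by
    refine Finset.card_le_card_of_injOn (fun z => (z.1.swap, z.2.swap)) ?_ ?_
    · rintro ⟨⟨a, b⟩, c, d⟩ hz
      simp only [hX, Finset.coe_filter, Finset.mem_product, Set.mem_ofPred_eq, Prod.swap] at hz ⊢
      exact ⟨by tauto, hz.2⟩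
    · rintro ⟨⟨a, b⟩, c, d⟩ _ ⟨⟨a', b'⟩, c', d'⟩ _ h
      simp only [Prod.mk.injEq, Prod.swap] at h ⊢
      tauto
  rw [h0, h1]
  omega

/-- The second moment of the number of representations as a quotient is controlled by its
dyadic level sets. -/
theorem sum_card_quotientRep_sq_le {G : Type*} [Group G] [DecidableEq G] (S : Finset G) (B : ℕ)
    (hB : ∀ (L : Finset G) (N : ℕ), (∀ g ∈ L, N ≤ (quotientRep S g).card) → L.card * N ^ 2 ≤ B) :
    ∑ g ∈ (S ×ˢ S).image (fun p => p.1 * p.2⁻¹), (quotientRep S g).card ^ 2 ≤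
      (Nat.log 2 S.card + 1) * (4 * B) := by
  set V := (S ×ˢ S).image (fun p => p.1 * p.2⁻¹) with hV
  have hpos : ∀ g ∈ V, (quotientRep S g).card ≠ 0 := by
    intro g hg
    obtain ⟨p, hp, hpg⟩ := Finset.mem_image.1 hg
    exact Finset.card_ne_zero_of_mem (mem_quotientRep.2 ⟨Finset.mem_product.1 hp, hpg⟩)
  have hmaps : ∀ g ∈ V, Nat.log 2 (quotientRep S g).card ∈ Finset.range (Nat.log 2 S.card + 1) :=
    fun g _ => Finset.mem_range.2 (Nat.lt_succ_of_le (Nat.log_mono_right (card_quotientRep_le S g)))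
  rw [← Finset.sum_fiberwise_of_maps_to hmaps]
  have : ∀ m ∈ Finset.range (Nat.log 2 S.card + 1),
      ∑ g ∈ V with Nat.log 2 (quotientRep S g).card = m, (quotientRep S g).card ^ 2 ≤ 4 * B := by
    intro m _
    set L := {g ∈ V | Nat.log 2 (quotientRep S g).card = m} with hL
    have h1 : L.card * (2 ^ m) ^ 2 ≤ B := hB L (2 ^ m) fun g hg => by
      obtain ⟨h1, h2⟩ := Finset.mem_filter.1 hg
      exact h2 ▸ Nat.pow_log_le_self 2 (hpos g h1)
    -- On a level the counts vary by a factor less than 2, which costs 4 after squaring.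
    calc ∑ g ∈ L, (quotientRep S g).card ^ 2 ≤ L.card • (2 ^ (m + 1)) ^ 2 := by
          refine Finset.sum_le_card_nsmul _ _ _ fun g hg => ?_
          obtain ⟨-, h2⟩ := Finset.mem_filter.1 hg
          refine Nat.pow_le_pow_left ?_ 2
          exact h2 ▸ (Nat.lt_pow_succ_log_self one_lt_two _).le
      _ = 4 * (L.card * (2 ^ m) ^ 2) := by rw [smul_eq_mul, pow_succ]; ring
      _ ≤ 4 * B := by gcongr
  refine (Finset.sum_le_sum this).trans_eq ?_
  rw [Finset.sum_const, Finset.card_range, smul_eq_mul]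

/-! ### Cones and the estimate in a normed algebra. -/

/-- Units with bounded condition number can be split into boundedly many narrow cones. -/
theorem exists_subset_cone {R : Type*} [NormedRing R] [NormedAlgebra ℝ R]
    [FiniteDimensional ℝ R] [NormOneClass R] (M : ℝ) :
    ∃ n : ℕ, 0 < n ∧ ∀ S : Finset Rˣ, (∀ a ∈ S, ‖(a : R)‖ * ‖((a⁻¹ : Rˣ) : R)‖ ≤ M) →
      ∃ S' ⊆ S, S.card ≤ n * S'.card ∧ ∀ b ∈ S', ∀ d ∈ S', ∃ s : ℝ, 0 < s ∧
        ‖((b * d⁻¹ : Rˣ) : R) - algebraMap ℝ R s‖ < s := by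
  classical
  have : Nontrivial R := NormOneClass.nontrivial
  have : ProperSpace R := FiniteDimensional.proper ℝ R
  -- Chosen so that `2 * δ * (|M| + 1) = 1`: two directions in one `δ`-ball differ by less than `2 *
  -- δ`, and inverting `d` loses at most `|M| + 1`. The form `|M| + 1` keeps `δ` positive for every
  -- real `M`.
  set δ : ℝ := (2 * (|M| + 1))⁻¹ with hδ
  have hδ0 : 0 < δ := by positivity
  obtain ⟨t, -, htf, htc⟩ := (isCompact_sphere (0 : R) 1).finite_cover_balls hδ0
  have hcov : ∀ a : Rˣ, ∃ x ∈ htf.toFinset, ‖‖(a : R)‖⁻¹ • (a : R) - x‖ < δ := by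
    intro a
    have ha : ‖(a : R)‖⁻¹ • (a : R) ∈ Metric.sphere (0 : R) 1 := by
      rw [mem_sphere_zero_iff_norm, norm_smul, norm_inv, norm_norm,
        inv_mul_cancel₀ (norm_ne_zero_iff.2 a.ne_zero)]
    obtain ⟨x, hx, hax⟩ := Set.mem_iUnion₂.1 (htc ha)
    exact ⟨x, htf.mem_toFinset.2 hx, mem_ball_iff_norm.1 hax⟩
  choose f hft hf using hcov
  have hne : htf.toFinset.Nonempty := ⟨f 1, hft 1⟩
  refine ⟨htf.toFinset.card, Finset.card_pos.2 hne, fun S hS => ?_⟩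
  obtain ⟨x, -, hmax⟩ := htf.toFinset.exists_max_image
    (fun x => {a ∈ S | f a = x}.card) hne
  refine ⟨{a ∈ S | f a = x}, Finset.filter_subset _ _, ?_, ?_⟩
  · rw [Finset.card_eq_sum_card_fiberwise (f := f) (t := htf.toFinset) fun a _ => hft a,
      ← smul_eq_mul]
    exact Finset.sum_le_card_nsmul _ _ _ hmax
  · intro b hb d hd
    obtain ⟨-, hb⟩ := Finset.mem_filter.1 hb
    obtain ⟨hdS, hd⟩ := Finset.mem_filter.1 hd
    have hb0 : 0 < ‖(b : R)‖ := norm_pos_iff.2 b.ne_zero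
    have hd0 : 0 < ‖(d : R)‖ := norm_pos_iff.2 d.ne_zero
    refine ⟨‖(b : R)‖ * ‖(d : R)‖⁻¹, by positivity, ?_⟩
    set u := ‖(b : R)‖⁻¹ • (b : R) with hu
    set v := ‖(d : R)‖⁻¹ • (d : R) with hv
    have huv : ‖u - v‖ < 2 * δ := by
      have h1 : ‖u - x‖ < δ := by have := hf b; rwa [hb] at this
      have h2 : ‖v - x‖ < δ := by have := hf d; rwa [hd] at this
      calc ‖u - v‖ = ‖(u - x) - (v - x)‖ := by rw [sub_sub_sub_cancel_right]
        _ ≤ ‖u - x‖ + ‖v - x‖ := norm_sub_le _ _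
        _ < 2 * δ := by linarith
    have hbu : (b : R) = ‖(b : R)‖ • u := by rw [hu, smul_inv_smul₀ hb0.ne']
    have heq : ((b * d⁻¹ : Rˣ) : R) - algebraMap ℝ R (‖(b : R)‖ * ‖(d : R)‖⁻¹) =
        ‖(b : R)‖ • ((u - v) * (d⁻¹ : Rˣ)) := by
      have hvd : v * (d⁻¹ : Rˣ) = ‖(d : R)‖⁻¹ • (1 : R) := by
        rw [hv, smul_mul_assoc, Units.mul_inv]
      rw [sub_mul, smul_sub, hvd, ← smul_mul_assoc, ← hbu, smul_smul, Units.val_mul,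
        Algebra.algebraMap_eq_smul_one]
    have hdi : 0 < ‖((d⁻¹ : Rˣ) : R)‖ := norm_pos_iff.2 (d⁻¹).ne_zero
    have hM : ‖((d⁻¹ : Rˣ) : R)‖ ≤ (|M| + 1) * ‖(d : R)‖⁻¹ := by
      rw [← div_eq_mul_inv, le_div_iff₀ hd0, mul_comm]
      linarith [hS d hdS, le_abs_self M]
    rw [heq, norm_smul, norm_norm]
    refine mul_lt_mul_of_pos_left ?_ hb0
    calc ‖(u - v) * (d⁻¹ : Rˣ)‖ ≤ ‖u - v‖ * ‖((d⁻¹ : Rˣ) : R)‖ := norm_mul_le _ _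
      _ < 2 * δ * ‖((d⁻¹ : Rˣ) : R)‖ := mul_lt_mul_of_pos_right huv hdi
      _ ≤ 2 * δ * ((|M| + 1) * ‖(d : R)‖⁻¹) := by gcongr
      _ = ‖(d : R)‖⁻¹ := by rw [hδ]; field_simp

/-- Sum-product estimate for units of bounded condition number in a finite-dimensional normed
algebra. -/
theorem exists_card_pow_four_le {R : Type*} [NormedRing R] [NormedAlgebra ℝ R]
    [FiniteDimensional ℝ R] [NormOneClass R] [DecidableEq Rˣ] (M : ℝ) :
    ∃ C : ℕ, 0 < C ∧ ∀ (S : Finset Rˣ) (T : Finset R),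
      (∀ a ∈ S, ‖(a : R)‖ * ‖((a⁻¹ : Rˣ) : R)‖ ≤ M) →
      (∀ a ∈ S, ∀ b ∈ S, ∀ c ∈ S, ∀ d ∈ S, a * b⁻¹ ≠ c * d⁻¹ →
        IsUnit (((a * b⁻¹ : Rˣ) : R) - ((c * d⁻¹ : Rˣ) : R))) →
      (∀ a ∈ S, ∀ b ∈ S, (a + b : R) ∈ T) →
      S.card ^ 4 ≤ C * (Nat.log 2 S.card + 1) * (T.card ^ 2 * (S * S).card) := by
  obtain ⟨n, hn, hcone⟩ := exists_subset_cone (R := R) M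
  set K := 5 ^ Module.finrank ℝ R + 1 with hK
  refine ⟨n ^ 4 * (4 * K), by positivity, fun S T hM hdiff hT => ?_⟩
  obtain ⟨S', hSS, hcard, hc⟩ := hcone S hM
  have h1 := Finset.le_card_mul_mul_mulEnergy S' S'
  have h2 := mulEnergy_le_sum_card_quotientRep_sq S'
  have h3 := sum_card_quotientRep_sq_le S' (K * T.card ^ 2) fun L N hL =>
    card_mul_sq_le_of_le_card_quotientRep S' hc
      (fun a ha b hb c hc d hd => hdiff a (hSS ha) b (hSS hb) c (hSS hc) d (hSS hd)) T
      (fun a ha b hb => hT a (hSS ha) b (hSS hb)) L N hL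
  have h4 : (S' * S').card ≤ (S * S).card := Finset.card_le_card (Finset.mul_subset_mul hSS hSS)
  have h5 : Nat.log 2 S'.card ≤ Nat.log 2 S.card := Nat.log_mono_right (Finset.card_le_card hSS)
  calc S.card ^ 4 ≤ (n * S'.card) ^ 4 := by gcongr
    _ = n ^ 4 * (S'.card ^ 2 * S'.card ^ 2) := by ring
    _ ≤ n ^ 4 * ((S * S).card * ((Nat.log 2 S.card + 1) * (4 * (K * T.card ^ 2)))) := by
        refine Nat.mul_le_mul_left _ (h1.trans (Nat.mul_le_mul h4 ((h2.trans h3).trans ?_)))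
        gcongr
    _ = _ := by ring

/-! ### Transfer to complex matrices. -/

theorem norm_apply_le_opOneNorm {k : ℕ} (A : Matrix (Fin k) (Fin k) ℂ) (i j : Fin k) :
    ‖A i j‖ ≤ opOneNorm A :=
  (Finset.single_le_sum (f := fun i => ‖A i j‖) (fun _ _ => norm_nonneg _)
    (Finset.mem_univ i)).trans
    (le_ciSup (f := fun j : Fin k => ∑ i : Fin k, ‖A i j‖) (Set.finite_range _).bddAbove j)

theorem opOneNorm_nonneg {k : ℕ} (A : Matrix (Fin k) (Fin k) ℂ) : 0 ≤ opOneNorm A :=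
  Real.iSup_nonneg fun _ => Finset.sum_nonneg fun _ _ => norm_nonneg _

/-- If the block matrix with columns `(A, B)` and `(C, D)` is invertible, then so is
`A B⁻¹ - C D⁻¹`. -/
theorem isUnit_sub_of_isUnit_fromBlocks {m K : Type*} [Fintype m] [DecidableEq m] [Field K]
    {A B C D : Matrix m m K} (hB : IsUnit B) (hD : IsUnit D)
    (h : IsUnit (Matrix.fromBlocks A C B D)) : IsUnit (A * B⁻¹ - C * D⁻¹) := by
  rw [Matrix.isUnit_iff_isUnit_det] at hB hD h ⊢
  -- Block elimination of `C` by means of `D`; the Schur complement is `(A * B⁻¹ - C * D⁻¹) * B`.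
  have h1 : Matrix.fromBlocks A C B D =
      Matrix.fromBlocks 1 (C * D⁻¹) 0 1 *
        Matrix.fromBlocks ((A * B⁻¹ - C * D⁻¹) * B) 0 B D := by
    rw [Matrix.fromBlocks_multiply]
    congr 1
    · rw [Matrix.one_mul, sub_mul, Matrix.nonsing_inv_mul_cancel_right _ _ hB]; abel
    · rw [Matrix.mul_zero, zero_add, Matrix.nonsing_inv_mul_cancel_right _ _ hD]
    · simp
    · simp
  rw [h1, Matrix.det_mul, Matrix.det_fromBlocks_zero₁₂, Matrix.det_mul] at h
  exact isUnit_of_mul_isUnit_left (isUnit_of_mul_isUnit_left (isUnit_of_mul_isUnit_right h))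

section LinftyOpNorm

attribute [local instance] Matrix.linftyOpNormedRing Matrix.linftyOpNormedAlgebra

/-- The norm used for the algebra is the maximal row sum, while `opOneNorm` is the maximal column
sum. Each row has `k` entries, so condition numbers change by at most `k * k`. -/
theorem linfty_opNorm_le_opOneNorm {k : ℕ} (A : Matrix (Fin k) (Fin k) ℂ) :
    ‖A‖ ≤ k * opOneNorm A := by
  have h0 : 0 ≤ k * opOneNorm A := mul_nonneg k.cast_nonneg (opOneNorm_nonneg A)
  rw [Matrix.linfty_opNorm_def, ← Real.coe_toNNReal _ h0, NNReal.coe_le_coe]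
  refine Finset.sup_le fun i _ => ?_
  rw [← NNReal.coe_le_coe, Real.coe_toNNReal _ h0, NNReal.coe_sum]
  refine (Finset.sum_le_card_nsmul _ _ (opOneNorm A) fun j _ => ?_).trans_eq ?_
  · exact norm_apply_le_opOneNorm A i j
  · rw [Finset.card_univ, Fintype.card_fin, nsmul_eq_mul]

theorem exists_card_pow_four_le_of_condNumber_le (k : ℕ) (hk : 0 < k) (M : ℝ) :
    ∃ C : ℕ, 0 < C ∧ ∀ 𝒜 : Finset (Matrix (Fin k) (Fin k) ℂ),
      (∀ A ∈ 𝒜, IsUnit A) →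
      (∀ A ∈ 𝒜, ∀ B ∈ 𝒜, ∀ C ∈ 𝒜, ∀ D ∈ 𝒜,
        A * B⁻¹ = C * D⁻¹ ∨ IsUnit (Matrix.fromBlocks A C B D)) →
      (∀ A ∈ 𝒜, condNumber A ≤ M) →
      𝒜.card ^ 4 ≤ C * (Nat.log 2 𝒜.card + 1) * ((𝒜 + 𝒜).card ^ 2 * (𝒜 * 𝒜).card) := by
  classical
  have : Nonempty (Fin k) := ⟨⟨0, hk⟩⟩
  have : NormOneClass (Matrix (Fin k) (Fin k) ℂ) := Matrix.linfty_opNormOneClass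
  have : FiniteDimensional ℝ (Matrix (Fin k) (Fin k) ℂ) :=
    FiniteDimensional.complexToReal _
  obtain ⟨C, hC, h⟩ := exists_card_pow_four_le (R := Matrix (Fin k) (Fin k) ℂ) (k * k * M)
  refine ⟨C, hC, fun 𝒜 hU hblock hcond => ?_⟩
  obtain ⟨S, hS, hcard⟩ : ∃ S : Finset (Matrix (Fin k) (Fin k) ℂ)ˣ,
      (∀ a ∈ S, (a : Matrix (Fin k) (Fin k) ℂ) ∈ 𝒜) ∧ S.card = 𝒜.card := by
    refine ⟨𝒜.attach.image fun A => (hU A.1 A.2).unit, fun a ha => ?_, ?_⟩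
    · obtain ⟨A, -, rfl⟩ := Finset.mem_image.1 ha
      exact A.2
    · rw [Finset.card_image_of_injective, Finset.card_attach]
      intro A B hAB
      exact Subtype.ext (congrArg Units.val hAB)
  have hinv : ∀ a b : (Matrix (Fin k) (Fin k) ℂ)ˣ, ((a * b⁻¹ : (Matrix (Fin k) (Fin k) ℂ)ˣ) :
      Matrix (Fin k) (Fin k) ℂ) = (a : Matrix (Fin k) (Fin k) ℂ) * (b : Matrix _ _ ℂ)⁻¹ :=
    fun a b => by rw [Units.val_mul, Matrix.coe_units_inv]
  have hmain := h S (𝒜 + 𝒜) (fun a ha => ?_) (fun a ha b hb c hc d hd hne => ?_)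
    (fun a ha b hb => Finset.add_mem_add (hS a ha) (hS b hb))
  · have hmul : (S * S).card ≤ (𝒜 * 𝒜).card := by
      refine Finset.card_le_card_of_injOn Units.val (fun x hx => ?_) Units.val_injective.injOn
      obtain ⟨a, ha, b, hb, rfl⟩ := Finset.mem_mul.1 hx
      exact Finset.mul_mem_mul (hS a ha) (hS b hb)
    rw [hcard] at hmain
    exact hmain.trans (by gcongr)
  · rw [Matrix.coe_units_inv]
    have h0 := hcond _ (hS a ha)
    rw [condNumber] at h0
    calc _ ≤ (k * opOneNorm (a : Matrix (Fin k) (Fin k) ℂ)) *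
          (k * opOneNorm (a : Matrix (Fin k) (Fin k) ℂ)⁻¹) :=
        mul_le_mul (linfty_opNorm_le_opOneNorm _) (linfty_opNorm_le_opOneNorm _) (norm_nonneg _)
          (mul_nonneg k.cast_nonneg (opOneNorm_nonneg _))
      _ = k * k * (opOneNorm (a : Matrix (Fin k) (Fin k) ℂ) *
          opOneNorm (a : Matrix (Fin k) (Fin k) ℂ)⁻¹) := by ring
      _ ≤ k * k * M := by gcongr
  · rw [hinv, hinv]
    refine isUnit_sub_of_isUnit_fromBlocks b.isUnit d.isUnit
      ((hblock _ (hS a ha) _ (hS b hb) _ (hS c hc) _ (hS d hd)).resolve_left fun h => hne ?_)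
    exact Units.ext (by rw [hinv, hinv, h])

end LinftyOpNorm

/-! ### From the fourth-power inequality to the final bound. -/

/-- Since `1 / log 2 < 2`, the binary logarithm costs at most two copies of the ceiling; the added
`1` costs the third, as the ceiling is at least 1. -/
theorem natLog_two_add_one_le {n : ℕ} (hn : 2 ≤ n) :
    ((Nat.log 2 n + 1 : ℕ) : ℝ) ≤ 3 * (⌈Real.log n⌉ : ℝ) := by
  have hn1 : (1 : ℝ) < n := by exact_mod_cast hn
  have hpos : 0 < Real.log n := Real.log_pos hn1
  have h1 : (1 : ℝ) ≤ (⌈Real.log n⌉ : ℝ) := by exact_mod_cast Int.ceil_pos.2 hpos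
  have h2 : Real.log n ≤ (⌈Real.log n⌉ : ℝ) := Int.le_ceil _
  have h3 : (Nat.log 2 n : ℝ) * Real.log 2 ≤ Real.log n := by
    rw [← Real.log_pow]
    refine Real.log_le_log (by positivity) ?_
    exact_mod_cast Nat.pow_log_le_self 2 (by omega)
  have h4 : (0 : ℝ) ≤ Nat.log 2 n := Nat.cast_nonneg _
  push_cast
  nlinarith [Real.log_two_gt_d9]

theorem mainTheorem2 (k : ℕ) (M : ℝ) :
    ∃ c : ℝ, 0 < c ∧
      ∀ 𝒜 : Finset (Matrix (Fin k) (Fin k) ℂ),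
        2 ≤ 𝒜.card →
        (∀ A ∈ 𝒜, IsUnit A) →
        (∀ A ∈ 𝒜, ∀ B ∈ 𝒜, ∀ C ∈ 𝒜, ∀ D ∈ 𝒜,
          A * B⁻¹ = C * D⁻¹ ∨ IsUnit (Matrix.fromBlocks A C B D)) →
        (∀ A ∈ 𝒜, condNumber A ≤ M) →
        c * ((𝒜.card : ℝ) ^ (4 / 3 : ℝ) /
            (⌈Real.log (𝒜.card : ℝ)⌉ : ℝ) ^ (1 / 3 : ℝ)) ≤
          max ((𝒜 + 𝒜).card : ℝ) ((𝒜 * 𝒜).card : ℝ) := by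
  rcases k.eq_zero_or_pos with rfl | hk
  -- For `k = 0` there is only one matrix, so no set has two elements.
  · refine ⟨1, one_pos, fun 𝒜 h𝒜 => ?_⟩
    have := Finset.card_le_one_of_subsingleton 𝒜
    omega
  obtain ⟨C, hC, h⟩ := exists_card_pow_four_le_of_condNumber_le k hk M
  have hC0 : (0 : ℝ) < 3 * C := by positivity
  -- The cube root undoes the cubing of the final inequality; the 3 comes from
  -- `natLog_two_add_one_le`.
  refine ⟨((3 * C : ℝ) ^ (1 / 3 : ℝ))⁻¹, by positivity, fun 𝒜 h2 hU hblock hcond => ?_⟩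
  have h4 := h 𝒜 hU hblock hcond
  have hlog := natLog_two_add_one_le h2
  set X : ℝ := max ((𝒜 + 𝒜).card : ℝ) ((𝒜 * 𝒜).card : ℝ) with hX
  set l : ℝ := (⌈Real.log (𝒜.card : ℝ)⌉ : ℝ) with hl
  have hX0 : 0 ≤ X := le_max_of_le_left (Nat.cast_nonneg _)
  have hl0 : 0 < l := by
    have : (0 : ℝ) < ((Nat.log 2 𝒜.card + 1 : ℕ) : ℝ) := by positivity
    linarith
  have h5 : (𝒜.card : ℝ) ^ 4 ≤ 3 * C * l * X ^ 3 := by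
    calc (𝒜.card : ℝ) ^ 4
        ≤ C * ((Nat.log 2 𝒜.card + 1 : ℕ) : ℝ) *
          (((𝒜 + 𝒜).card : ℝ) ^ 2 * ((𝒜 * 𝒜).card : ℝ)) := by exact_mod_cast h4
      _ ≤ C * (3 * l) * (X ^ 2 * X) := by
          gcongr
          · exact le_max_left _ _
          · exact le_max_right _ _
      _ = _ := by ring
  have cube : ∀ x : ℝ, 0 ≤ x → (x ^ (1 / 3 : ℝ)) ^ 3 = x := fun x hx => by
    rw [← Real.rpow_natCast, ← Real.rpow_mul hx]; norm_num
  have h6 : ((𝒜.card : ℝ) ^ (4 / 3 : ℝ)) ^ 3 = (𝒜.card : ℝ) ^ 4 := by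
    rw [← Real.rpow_natCast, ← Real.rpow_mul (Nat.cast_nonneg _), ← Real.rpow_natCast]; norm_num
  refine le_of_pow_le_pow_left₀ three_ne_zero hX0 ?_
  rw [mul_pow, div_pow, inv_pow, cube _ hC0.le, cube _ hl0.le, h6, inv_mul_le_iff₀ hC0,
    div_le_iff₀ hl0]
  linarith
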